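/- Permutations act on the right and are multiplied from left to right. Let $a\ge 1$, $i\in\{-1,1\}$ and $n=4a+7+i$. Consider the set $\Omega$ of points labelled $1,\dots,2a,\;1',\dots,(2a)',\;\alpha,\alpha',\beta,\beta',\gamma,\gamma',\delta,\delta',\varepsilon$ and, if $i=1$, one further point $\zeta$; let $k=|\Omega|$, so $k=4a+9$ if $i=-1$ and $k=4a+10$ if $i=1$. On $\Omega$ let $$t=(\alpha,\alpha')(\beta,\beta')(\gamma,\gamma')(\delta,\delta')\prod_{j=1}^{2a}(j,j')$$ and let $s=s_i$, where $$s_{-1}=(1,2,\dots,2a,\alpha,\alpha',\beta,(2a)',(2a-1)',\dots,1',\delta,\varepsilon,\delta')(\beta',\gamma),$$ $$s_{1}=(1,2,\dots,2a,\alpha,\alpha',\beta,\beta',\gamma,(2a)',(2a-1)',\dots,1',\delta,\varepsilon,\delta')(\gamma',\zeta).$$ Let $r=ts^{-1}$, so that $rs=t$, and let $G=\langle r,s\rangle=\langle s,t\rangle$. Let $\mathcal M(G:r,s)$ be the orientably-regular map whose arcs correspond to the elements of $G$, with orientation-preserving automorphism group $G$, such that $r$ and $s$ are the one-step rotations, in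 the same direction, about the face and the vertex incident with the base arc. Then $G$ is the alternating group $A_k$ on $\Omega$, and $\mathcal M(G:r,s)$ is a chiral map of type $\{6,n\}$: every face has length $6$, every vertex has valency $n$, and the map has no orientation-reversing automorphism; equivalently, no automorphism of $G$ inverts both $r$ and $s$. -/

import Mathlib

open Equiv

/-- A rotation system on a set `D` of arcs (darts): `rot` is the one-step rotation of each arc
about its initial vertex (in the direction of the chosen orientation of the surface), and `rev`
reverses each arc. -/
structure RotationSystem (D : Type*) where
  rot : Perm D
  rev : Perm D

namespace RotationSystem

variable {D : Type*} (M : RotationSystem D)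

/-- One-step rotation about the incident face, in the same sense as `rot`: rotating about the
vertex and then about the face reverses the arc. The cycles of `rot`, `rev`, `face` are
the vertices, edges and faces. -/
def face : Perm D := M.rev * M.rot⁻¹

/-- The rotation system describes a map on an oriented surface: the underlying graph is non-empty
and connected, and reversal of arcs is an involution without fixed points. -/
structure IsMap : Prop where
  nonempty : Nonempty D
  connected : MulAction.IsPretransitive (Subgroup.closure {M.rot, M.rev}) D
  rev_rev : ∀ d, M.rev (M.rev d) = d
  rev_ne : ∀ d, M.rev d ≠ d

/-- The group of orientation-preserving automorphisms: the permutations of the arcs that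
commute with `rot` and `rev`. -/
def autPlus : Subgroup (Perm D) := Subgroup.centralizer {M.rot, M.rev}

/-- Orientably-regular: a map whose orientation-preserving automorphisms are transitive on arcs. -/
def IsOrientablyRegular : Prop := M.IsMap ∧ MulAction.IsPretransitive M.autPlus D

/-- There is an orientation-reversing automorphism. -/
def IsReflexible : Prop :=
  ∃ ψ : Perm D, ψ * M.rot * ψ⁻¹ = M.rot⁻¹ ∧ ψ * M.rev * ψ⁻¹ = M.rev

/-- Chiral: orientably-regular but not reflexible. -/
def IsChiral : Prop := M.IsOrientablyRegular ∧ ¬ M.IsReflexible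

/-- Type `{m, n}`: every face has length `m` and every vertex has valency `n`. -/
def HasType (m n : ℕ) : Prop :=
  ∀ d, Function.minimalPeriod M.face d = m ∧ Function.minimalPeriod M.rot d = n

/-- The map `M(G : r, s)`. The arcs are the elements of `G`, on which `G` acts as automorphisms by
left multiplication; the arc `1` has `r` and `s` as the rotations about its face and its vertex, so
that the arc `g` is rotated about its face to `g * r` and about its vertex to `g * s`.
The edge involution is written `rs` for permutations multiplied from left to right, which is
`s * r` in the right-to-left multiplication used here. -/
def ofGroup {G : Type*} [Group G] (r s : G) : RotationSystem G where
  rot := Equiv.mulRight s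
  rev := Equiv.mulRight (s * r)

/-- Check of the conventions: the face rotation of `M(G : r, s)` is given by `r`. -/
theorem ofGroup_face {G : Type*} [Group G] (r s g : G) : (ofGroup r s).face g = g * r := by
  simp [face, ofGroup, mul_assoc]

end RotationSystem

/-- The permutation group `G = ⟨r, s⟩`. -/
def rotGroup {Ω : Type*} (r s : Perm Ω) : Subgroup (Perm Ω) := Subgroup.closure {r, s}

/-- The generator `r` as an element of `G = ⟨r, s⟩`. -/
def genR {Ω : Type*} (r s : Perm Ω) : rotGroup r s :=
  ⟨r, Subgroup.subset_closure (Set.mem_insert r {s})⟩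

/-- The generator `s` as an element of `G = ⟨r, s⟩`. -/
def genS {Ω : Type*} (r s : Perm Ω) : rotGroup r s :=
  ⟨s, Subgroup.subset_closure (Set.mem_insert_of_mem r rfl)⟩

/-- The map `M(G : r, s)` with `G = ⟨r, s⟩`. -/
def permMap {Ω : Type*} (r s : Perm Ω) : RotationSystem (rotGroup r s) :=
  RotationSystem.ofGroup (genR r s) (genS r s)

/-- The points of the permutation diagram. `num j` and `num' j` are the points labelled `j + 1` and
`(j + 1)'` (for `0 ≤ j < 2a`). There are `e` points labelled `ζ`: none for `e = 0` and one
for `e = 1`. -/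
inductive Pt (a e : ℕ) : Type
  | num (j : Fin (2 * a))
  | num' (j : Fin (2 * a))
  | α | α' | β | β' | γ | γ' | δ | δ' | ε
  | ζ (j : Fin e)
  deriving DecidableEq, Fintype

namespace Pt

/-- The sequence `1, 2, …, 2a`. -/
def up (a e : ℕ) : List (Pt a e) := List.ofFn num

/-- The sequence `2a', …, 2', 1'`. -/
def down (a e : ℕ) : List (Pt a e) := (List.ofFn num').reverse

/-- `t = (α, α')(β, β')(γ, γ')(δ, δ') ∏_{j=1}^{2a} (j, j')`. -/
def t (a e : ℕ) : Perm (Pt a e) :=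
  swap α α' * swap β β' * swap γ γ' * swap δ δ' *
    (List.ofFn fun j => swap (num j) (num' j)).prod

/-- `s₋₁ = (1, …, 2a, α, α', β, 2a', …, 1', δ, ε, δ')(β', γ)`. -/
def sMinus (a : ℕ) : Perm (Pt a 0) :=
  (up a 0 ++ [α, α', β] ++ down a 0 ++ [δ, ε, δ']).formPerm * swap β' γ

/-- `s₁ = (1, …, 2a, α, α', β, β', γ, 2a', …, 1', δ, ε, δ')(γ', ζ)`. -/
def sPlus (a : ℕ) : Perm (Pt a 1) :=
  (up a 1 ++ [α, α', β, β', γ] ++ down a 1 ++ [δ, ε, δ']).formPerm * swap γ' (ζ 0)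

/-- The generator `r` with `rs = t`, that is, `t` followed by `s⁻¹`. -/
def rMinus (a : ℕ) : Perm (Pt a 0) := (sMinus a)⁻¹ * t a 0

/-- The generator `r` with `rs = t`, that is, `t` followed by `s⁻¹`. -/
def rPlus (a : ℕ) : Perm (Pt a 1) := (sPlus a)⁻¹ * t a 1

end Pt

/-! The rotations of the map are right translations of G and its orientation-preserving
automorphisms are the left translations, so face length and valency are the orders of `r` and `s`.
The order of `s` is read off its cycles. The square of `r` is a product of two 3-cycles and `r`
interchanges `δ` and `ε`, so `r` has order 6.

Chirality: an orientation-reversing automorphism would yield a conjugation in the symmetric group on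
G inverting the images of both generators, so every relation between `r` and `s` would also hold
between their inverses. A single word refutes this. It is built from u = r² and its conjugate v by
s². Together these move at most ten points, in a pattern independent of `a`, so the word can be
evaluated in the symmetric group of degree 10: `chiralWord_minus` and `chiralWord_minus_inv`, and
likewise for plus.

G is alternating: both generators are even; G is primitive, by following a block through a point
fixed by `s` or by `t`; and a short product of conjugates of r² has a power that is a 3-cycle.
Jordan's theorem on primitive groups containing a 3-cycle finishes the proof. -/

/-! ### Regular maps of groups: automorphisms, reflexibility, type -/

section RegularMap

variable {G : Type*} [Group G] {r s : G}

/-- The word `(u v u v⁻¹) ^ m` with `u = x ^ 2` and `v = y ^ 2 * u * y ^ (-2)`. -/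
def chiralWord (m : ℕ) (x y : G) : G :=
  (x ^ 2 * (y ^ 2 * x ^ 2 * (y ^ 2)⁻¹) * x ^ 2 * (y ^ 2 * x ^ 2 * (y ^ 2)⁻¹)⁻¹) ^ m

theorem map_chiralWord {K : Type*} [Group K] (f : G →* K) (m : ℕ) (x y : G) :
    f (chiralWord m x y) = chiralWord m (f x) (f y) := by
  simp [chiralWord]

/-- A word that is a relation between `r` and `s` but not between their inverses prevents the
simultaneous inversion of both, in every group into which `G` embeds. -/
theorem not_inverted_of_chiralWord {K : Type*} [Group K] {m : ℕ} (h₁ : chiralWord m r s = 1)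
    (h₂ : chiralWord m r⁻¹ s⁻¹ ≠ 1) {f : G →* K} (hf : Function.Injective f) (χ : K →* K)
    (hr : χ (f r) = f r⁻¹) (hs : χ (f s) = f s⁻¹) : False := by
  refine h₂ (hf ?_)
  rw [map_one, map_chiralWord, ← hr, ← hs, ← map_chiralWord, ← map_chiralWord, h₁, map_one, map_one]

/-- Right translation by the inverse, as a homomorphism. -/
def mulRightInvHom (G : Type*) [Group G] : G →* Perm G where
  toFun g := Equiv.mulRight g⁻¹
  map_one' := by ext; simp
  map_mul' a b := by ext; simp [mul_assoc]

theorem mulRightInvHom_injective : Function.Injective (mulRightInvHom G) := fun a b h => by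
  simpa [mulRightInvHom] using Equiv.congr_fun h 1

/-- The preimage of the closure under the right regular representation is a subgroup containing `s`
and `s * r`, hence both generators of G. -/
theorem mulRight_mem_closure (hG : Subgroup.closure {r, s} = ⊤) (g : G) :
    Equiv.mulRight g ∈ Subgroup.closure
      {(RotationSystem.ofGroup r s).rot, (RotationSystem.ofGroup r s).rev} := by
  set H := Subgroup.closure {(RotationSystem.ofGroup r s).rot, (RotationSystem.ofGroup r s).rev}
  have hs : s ∈ H.comap (mulRightInvHom G) := by
    rw [Subgroup.mem_comap, ← inv_mem_iff, ← map_inv]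
    have : mulRightInvHom G s⁻¹ = (RotationSystem.ofGroup r s).rot := by
      simp [mulRightInvHom, RotationSystem.ofGroup]
    rw [this]
    exact Subgroup.subset_closure (by simp)
  have ht : s * r ∈ H.comap (mulRightInvHom G) := by
    rw [Subgroup.mem_comap, ← inv_mem_iff, ← map_inv]
    have : mulRightInvHom G (s * r)⁻¹ = (RotationSystem.ofGroup r s).rev := by
      ext; simp [mulRightInvHom, RotationSystem.ofGroup]
    rw [this]
    exact Subgroup.subset_closure (by simp)
  have hr : r ∈ H.comap (mulRightInvHom G) := by
    simpa using mul_mem (inv_mem hs) ht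
  have htop : H.comap (mulRightInvHom G) = ⊤ := by
    rw [eq_top_iff, ← hG, Subgroup.closure_le]
    rintro x (rfl | rfl)
    exacts [hr, hs]
  have : g⁻¹ ∈ H.comap (mulRightInvHom G) := htop ▸ Subgroup.mem_top _
  rwa [Subgroup.mem_comap, show mulRightInvHom G g⁻¹ = Equiv.mulRight g by
    simp [mulRightInvHom]] at this

theorem ofGroup_isMap (hG : Subgroup.closure {r, s} = ⊤) (ht : (s * r) * (s * r) = 1)
    (ht1 : s * r ≠ 1) : (RotationSystem.ofGroup r s).IsMap where
  nonempty := ⟨1⟩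
  connected := ⟨fun x y => ⟨⟨_, mulRight_mem_closure hG (x⁻¹ * y)⟩, by
    simp [Subgroup.smul_def]⟩⟩
  rev_rev d := by
    change d * (s * r) * (s * r) = d
    rw [mul_assoc, ht, mul_one]
  rev_ne d := by
    change d * (s * r) ≠ d
    simpa using ht1

theorem mulLeft_mem_autPlus (g : G) :
    Equiv.mulLeft g ∈ (RotationSystem.ofGroup r s).autPlus := by
  rw [RotationSystem.autPlus, Subgroup.mem_centralizer_iff]
  rintro h (rfl | rfl) <;> ext x <;> simp [RotationSystem.ofGroup, mul_assoc]

/-- The orientation-preserving automorphisms of `M(G : r, s)` are the left translations. -/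
noncomputable def autPlusEquiv (hG : Subgroup.closure {r, s} = ⊤) :
    (RotationSystem.ofGroup r s).autPlus ≃* G :=
  MulEquiv.symm <| MulEquiv.ofBijective
    ({ toFun := fun g => ⟨Equiv.mulLeft g, mulLeft_mem_autPlus g⟩
       map_one' := by ext; simp
       map_mul' := fun a b => by ext; simp } :
      G →* (RotationSystem.ofGroup r s).autPlus) <| by
    refine ⟨fun a b h => ?_, fun ψ => ⟨ψ.1 1, Subtype.ext (Equiv.ext fun g => ?_)⟩⟩
    · simpa using Equiv.congr_fun (congrArg Subtype.val h) 1
    -- Commuting with `rot` and `rev` entails commuting with all right translations, so ψ g = ψ (1 *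
    -- g) = ψ 1 * g.
    · have hle : Subgroup.closure
          {(RotationSystem.ofGroup r s).rot, (RotationSystem.ofGroup r s).rev} ≤
            Subgroup.centralizer {ψ.1} := by
        rw [Subgroup.closure_le]
        intro x hx
        rw [SetLike.mem_coe, Subgroup.mem_centralizer_singleton_iff]
        exact Subgroup.mem_centralizer_iff.1 ψ.2 x hx
      have := Subgroup.mem_centralizer_singleton_iff.1 (hle (mulRight_mem_closure hG g))
      simpa using Equiv.congr_fun this 1

theorem ofGroup_isOrientablyRegular (hG : Subgroup.closure {r, s} = ⊤)
    (ht : (s * r) * (s * r) = 1) (ht1 : s * r ≠ 1) :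
    (RotationSystem.ofGroup r s).IsOrientablyRegular :=
  ⟨ofGroup_isMap hG ht ht1, ⟨fun x y => ⟨⟨_, mulLeft_mem_autPlus (y * x⁻¹)⟩, by
    simp [Subgroup.smul_def]⟩⟩⟩

theorem ofGroup_not_isReflexible (ht : (s * r) * (s * r) = 1) {m : ℕ}
    (h₁ : chiralWord m r s = 1) (h₂ : chiralWord m r⁻¹ s⁻¹ ≠ 1) :
    ¬ (RotationSystem.ofGroup r s).IsReflexible := by
  rintro ⟨ψ, hrot, hrev⟩
  set ρ := mulRightInvHom G
  have e1 : (RotationSystem.ofGroup r s).rot = (ρ s)⁻¹ := by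
    rw [← map_inv]; ext; simp [ρ, mulRightInvHom, RotationSystem.ofGroup]
  have e2 : (RotationSystem.ofGroup r s).rev = (ρ (s * r))⁻¹ := by
    rw [← map_inv]; ext; simp [ρ, mulRightInvHom, RotationSystem.ofGroup]
  rw [e1, inv_inv] at hrot
  rw [e2] at hrev
  have k1 : ψ * ρ s * ψ⁻¹ = (ρ s)⁻¹ := by
    simpa [mul_assoc] using congrArg (·⁻¹) hrot
  have k2 : ψ * ρ (s * r) * ψ⁻¹ = ρ (s * r) := by
    have := congrArg (·⁻¹) hrev
    simpa [mul_assoc] using this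
  have hr : r⁻¹ = s * r * s := by
    rw [inv_eq_iff_mul_eq_one, ← mul_left_inj s⁻¹, ← mul_right_inj s]
    simpa [mul_assoc] using ht
  -- Conjugation by ψ inverts s and fixes sr, so it sends r = s⁻¹(sr) to s²r. A further conjugation
  -- by s⁻¹ turns this into srs = r⁻¹ and leaves s⁻¹ alone.
  refine not_inverted_of_chiralWord h₁ h₂ mulRightInvHom_injective
    (MulAut.conj ((ρ s)⁻¹ * ψ)).toMonoidHom ?_ ?_
  · have : r = s⁻¹ * (s * r) := by group
    change ((ρ s)⁻¹ * ψ) * ρ r * ((ρ s)⁻¹ * ψ)⁻¹ = ρ r⁻¹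
    calc ((ρ s)⁻¹ * ψ) * ρ r * ((ρ s)⁻¹ * ψ)⁻¹
        = (ρ s)⁻¹ * ((ψ * ρ s * ψ⁻¹)⁻¹ * (ψ * ρ (s * r) * ψ⁻¹)) * ρ s := by
          rw [map_mul]; group
      _ = ρ r⁻¹ := by rw [k1, k2, hr]; simp [mul_assoc]
  · change ((ρ s)⁻¹ * ψ) * ρ s * ((ρ s)⁻¹ * ψ)⁻¹ = ρ s⁻¹
    calc ((ρ s)⁻¹ * ψ) * ρ s * ((ρ s)⁻¹ * ψ)⁻¹
        = (ρ s)⁻¹ * (ψ * ρ s * ψ⁻¹) * ρ s := by group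
      _ = ρ s⁻¹ := by rw [k1, map_inv]; group

theorem minimalPeriod_of_eq_mul_right {f : G → G} {x : G} (hf : ∀ g, f g = g * x) (g : G) :
    Function.minimalPeriod f g = orderOf x := by
  have hn : ∀ n : ℕ, f^[n] g = g * x ^ n := fun n => by
    induction n with
    | zero => simp
    | succ n ih => rw [Function.iterate_succ_apply', ih, hf, pow_succ, mul_assoc]
  rw [orderOf, Function.minimalPeriod_eq_minimalPeriod_iff]
  intro n
  rw [Function.IsPeriodicPt, Function.IsFixedPt, hn, isPeriodicPt_mul_iff_pow_eq_one]
  simp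

theorem ofGroup_hasType : (RotationSystem.ofGroup r s).HasType (orderOf r) (orderOf s) :=
  fun g => ⟨minimalPeriod_of_eq_mul_right (RotationSystem.ofGroup_face r s) g,
    minimalPeriod_of_eq_mul_right (fun _ => rfl) g⟩

end RegularMap

/-! ### From generating pairs of permutations to chiral maps -/

section PermGroup

variable {Ω : Type*}

theorem closure_genR_genS (r s : Perm Ω) : Subgroup.closure {genR r s, genS r s} = ⊤ := by
  have h : ({genR r s, genS r s} : Set (rotGroup r s)) =
      ((↑) : Subgroup.closure {r, s} → Perm Ω) ⁻¹' {r, s} := by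
    refine Set.ext fun x => ?_
    simp only [Set.mem_insert_iff, Set.mem_singleton_iff, Subtype.ext_iff]
    rfl
  rw [h]
  exact Subgroup.closure_closure_coe_preimage

/-- A generating pair of the alternating group of degree `k`, whose product is an involution and
which satisfies a relation that fails for the inverses, gives a chiral map. -/
theorem permMap_chiral [Fintype Ω] [DecidableEq Ω] {r s t : Perm Ω} {m p q k : ℕ}
    (hrt : r = s⁻¹ * t) (ht : t * t = 1) (ht1 : t ≠ 1) (hr : orderOf r = p) (hs : orderOf s = q)
    (h₁ : chiralWord m r s = 1) (h₂ : chiralWord m r⁻¹ s⁻¹ ≠ 1)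
    (hG : rotGroup r s = alternatingGroup Ω) (hk : Fintype.card Ω = k) :
    (permMap r s).IsChiral ∧ (permMap r s).HasType p q ∧ rotGroup r s = alternatingGroup Ω ∧
      Nonempty ((permMap r s).autPlus ≃* alternatingGroup (Fin k)) ∧
      ¬ ∃ φ : rotGroup r s ≃* rotGroup r s,
          φ (genR r s) = (genR r s)⁻¹ ∧ φ (genS r s) = (genS r s)⁻¹ := by
  have hsr : s * r = t := by rw [hrt]; group
  have hw (x y : rotGroup r s) :
      ((chiralWord m x y : rotGroup r s) : Perm Ω) = chiralWord m (x : Perm Ω) (y : Perm Ω) :=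
    map_chiralWord (rotGroup r s).subtype m x y
  have hR : ((genR r s : rotGroup r s) : Perm Ω) = r := rfl
  have hS : ((genS r s : rotGroup r s) : Perm Ω) = s := rfl
  have ht' : (genS r s * genR r s) * (genS r s * genR r s) = 1 := by
    rw [Subtype.ext_iff]
    simp only [Subgroup.coe_mul, Subgroup.coe_one, hR, hS, hsr, ht]
  have ht1' : genS r s * genR r s ≠ 1 := by
    rw [Ne, Subtype.ext_iff]
    simpa only [Subgroup.coe_mul, Subgroup.coe_one, hR, hS, hsr] using ht1
  have h₁' : chiralWord m (genR r s) (genS r s) = 1 := by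
    rw [Subtype.ext_iff, hw, hR, hS, h₁, Subgroup.coe_one]
  have h₂' : chiralWord m (genR r s)⁻¹ (genS r s)⁻¹ ≠ 1 := by
    rwa [Ne, Subtype.ext_iff, hw, Subgroup.coe_inv, Subgroup.coe_inv, hR, hS, Subgroup.coe_one]
  have hgen := closure_genR_genS r s
  refine ⟨⟨ofGroup_isOrientablyRegular hgen ht' ht1', ofGroup_not_isReflexible ht' h₁' h₂'⟩,
    ?_, hG, ?_, ?_⟩
  · have := ofGroup_hasType (r := genR r s) (s := genS r s)
    rwa [← Subgroup.orderOf_coe, ← Subgroup.orderOf_coe, hR, hS, hr, hs] at this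
  · exact ⟨(autPlusEquiv hgen).trans ((MulEquiv.subgroupCongr hG).trans
      (Equiv.altCongrHom (Fintype.equivFinOfCardEq hk)))⟩
  · rintro ⟨φ, h1, h2⟩
    exact not_inverted_of_chiralWord h₁' h₂' (f := MonoidHom.id _) Function.injective_id
      φ.toMonoidHom h1 h2

end PermGroup

/-! ### Cycles given by lists: values, order, sign -/

/-- Stating positions with `getElem?` lets indices into concatenated lists be rewritten without
carrying bound proofs along. -/
theorem List.formPerm_of_getElem? {α : Type*} [DecidableEq α] {l : List α} (hl : l.Nodup)
    {i : ℕ} {x y : α} (hx : l[i]? = some x) (hy : l[i + 1]? = some y) : l.formPerm x = y := by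
  obtain ⟨h1, rfl⟩ := List.getElem?_eq_some_iff.1 hx
  obtain ⟨h2, rfl⟩ := List.getElem?_eq_some_iff.1 hy
  exact List.formPerm_apply_lt_getElem l hl i h2

theorem List.formPerm_of_getElem?_last {α : Type*} [DecidableEq α] {l : List α} (hl : l.Nodup)
    {i : ℕ} {x y : α} (hx : l[i]? = some x) (hi : i + 1 = l.length) (hy : l[0]? = some y) :
    l.formPerm x = y := by
  obtain ⟨h1, rfl⟩ := List.getElem?_eq_some_iff.1 hx
  obtain ⟨h2, rfl⟩ := List.getElem?_eq_some_iff.1 hy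
  rw [List.formPerm_apply_getElem l hl i h1]
  simp [hi]

/-- A cycle of even length times a disjoint transposition has the length of the cycle as order. -/
theorem orderOf_formPerm_mul_swap {Ω : Type*} [Fintype Ω] [DecidableEq Ω] {l : List Ω}
    (hl : l.Nodup) {n : ℕ} (hn : l.length = 2 * n) (hn0 : 0 < n) {x y : Ω} (hx : x ∉ l)
    (hy : y ∉ l) (hxy : x ≠ y) : orderOf (l.formPerm * swap x y) = 2 * n := by
  have hd : (l.formPerm).Disjoint (swap x y) := fun z => by
    by_cases hz : z ∈ l
    · exact Or.inr (swap_apply_of_ne_of_ne (fun h => hx (h ▸ hz)) (fun h => hy (h ▸ hz)))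
    · exact Or.inl (List.formPerm_apply_of_notMem hz)
  have hc : l.formPerm.IsCycle := List.isCycle_formPerm hl (by omega)
  rw [hd.orderOf, hc.orderOf, List.support_formPerm_of_nodup l hl, List.toFinset_card_of_nodup hl,
    hn, (Perm.IsSwap.isCycle ⟨x, y, hxy, rfl⟩).orderOf, Perm.card_support_swap hxy]
  · exact Nat.lcm_eq_left ⟨n, rfl⟩
  · rintro z rfl
    simp at hn
    omega

/-- A cycle of even length and a transposition are both odd. -/
theorem sign_formPerm_mul_swap {Ω : Type*} [Fintype Ω] [DecidableEq Ω] {l : List Ω}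
    (hl : l.Nodup) {n : ℕ} (hn : l.length = 2 * n) (hn0 : 0 < n) {x y : Ω} (hxy : x ≠ y) :
    Perm.sign (l.formPerm * swap x y) = 1 := by
  have hc : l.formPerm.IsCycle := List.isCycle_formPerm hl (by omega)
  rw [Perm.sign_mul, hc.sign, List.support_formPerm_of_nodup l hl,
    List.toFinset_card_of_nodup hl, hn, Perm.sign_swap hxy]
  · simp [pow_mul]
  · rintro z rfl
    simp at hn
    omega

/-! ### The points and the action of `t` and `s` -/

namespace Pt

variable {a e : ℕ}

/-- The points, sorted into `1, …, 2a`, `1', …, 2a'`, the nine Greek letters up to `ε`, and `ζ`. -/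
def toSum : Pt a e → (Fin (2 * a) ⊕ Fin (2 * a)) ⊕ (Fin 9 ⊕ Fin e)
  | num j => .inl (.inl j)
  | num' j => .inl (.inr j)
  | α => .inr (.inl 0)
  | α' => .inr (.inl 1)
  | β => .inr (.inl 2)
  | β' => .inr (.inl 3)
  | γ => .inr (.inl 4)
  | γ' => .inr (.inl 5)
  | δ => .inr (.inl 6)
  | δ' => .inr (.inl 7)
  | ε => .inr (.inl 8)
  | ζ j => .inr (.inr j)

theorem toSum_bijective : Function.Bijective (toSum : Pt a e → _) := by
  constructor
  · intro x y h
    cases x <;> cases y <;> simp_all [toSum]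
  · rintro ((j | j) | (j | j))
    · exact ⟨num j, rfl⟩
    · exact ⟨num' j, rfl⟩
    · fin_cases j
      exacts [⟨α, rfl⟩, ⟨α', rfl⟩, ⟨β, rfl⟩, ⟨β', rfl⟩, ⟨γ, rfl⟩, ⟨γ', rfl⟩, ⟨δ, rfl⟩, ⟨δ', rfl⟩,
        ⟨ε, rfl⟩]
    · exact ⟨ζ j, rfl⟩

theorem card_eq : Fintype.card (Pt a e) = 4 * a + 9 + e := by
  rw [Fintype.card_of_bijective toSum_bijective]
  simp
  ring

/-- An arbitrary duplicate-free list, with membership tests in the values, makes induction possible;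
`t` uses the list of all indices. -/
theorem prod_swap_apply (l : List (Fin (2 * a))) (x : Pt a e) (hl : l.Nodup) :
    (l.map fun j => swap (num j) (num' j : Pt a e)).prod x =
      match x with
      | num j => if j ∈ l then num' j else num j
      | num' j => if j ∈ l then num j else num' j
      | y => y := by
  induction l with
  | nil => cases x <;> simp
  | cons i l ih =>
    rw [List.nodup_cons] at hl
    rw [List.map_cons, List.prod_cons, Perm.mul_apply, ih hl.2]
    cases x with
    | num j | num' j =>
      by_cases hj : j = i
      · subst hj; simp [hl.1]
      · by_cases hjl : j ∈ l <;> simp [hj, hjl, swap_apply_def]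
    | _ => simp [swap_apply_def]

theorem t_apply (x : Pt a e) : t a e x =
    match x with
    | num j => num' j
    | num' j => num j
    | α => α' | α' => α | β => β' | β' => β | γ => γ' | γ' => γ | δ => δ' | δ' => δ
    | y => y := by
  have h : (List.ofFn fun j => swap (num j) (num' j : Pt a e)) =
      (List.finRange (2 * a)).map fun j => swap (num j) (num' j) := List.ofFn_eq_map
  rw [t, h, Perm.mul_apply, prod_swap_apply _ _ (List.nodup_finRange _)]
  cases x <;> simp [swap_apply_def]

theorem t_mul_t : t a e * t a e = 1 := by
  ext x
  rw [Perm.mul_apply, t_apply, t_apply]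
  cases x <;> rfl

theorem t_ne_one : t a e ≠ 1 := fun h => by
  have := Equiv.congr_fun h α
  simp [t_apply] at this

/-- The number 2a + 4 of transpositions is even. -/
theorem sign_t : Perm.sign (t a e) = 1 := by
  have h : (Perm.sign (α := Pt a e)) ∘ (fun j => swap (num j) (num' j)) = fun _ => -1 :=
    funext fun j => by simp
  simp [t, map_list_prod, List.map_ofFn, h, pow_mul]

/-- The sequence `1, …, 2a`, followed by `l`, `2a', …, 1'` and `δ, ε, δ'`. -/
abbrev longList (l : List (Pt a e)) : List (Pt a e) := up a e ++ l ++ down a e ++ [δ, ε, δ']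

variable {l : List (Pt a e)}

theorem getElem?_longList_num (j : Fin (2 * a)) : (longList l)[(j : ℕ)]? = some (num j) := by
  simp [longList, up, List.getElem?_append, j.2]

theorem getElem?_longList_mid {i : ℕ} (hi : i < l.length) :
    (longList l)[2 * a + i]? = some l[i] := by
  simp [longList, up, List.getElem?_append, hi]

theorem getElem?_longList_num' {i : ℕ} (hi : i < 2 * a) :
    (longList l)[2 * a + l.length + i]? = some (num' ⟨2 * a - 1 - i, by omega⟩) := by
  rw [longList, List.getElem?_append_left (by simp [up, down]; omega),
    List.getElem?_append_right (by simp [up]), down, List.getElem?_reverse (by simp [up]; omega)]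
  simp [up]
  omega

theorem getElem?_longList_end (i : ℕ) :
    (longList l)[2 * a + l.length + 2 * a + i]? = [δ, ε, δ'][i]? := by
  rw [longList, List.getElem?_append_right (by simp [up, down]; omega)]
  congr 1
  simp [up, down]
  omega

theorem length_longList : (longList l).length = 4 * a + l.length + 3 := by
  simp [up, down]; ring

theorem nodup_longList_minus : (longList [α, α', β] : List (Pt a 0)).Nodup := by
  simp only [up, down, List.nodup_append, List.nodup_ofFn, List.nodup_reverse]
  simp [Function.Injective]
  constructor <;> intro x hx <;> rcases hx with ⟨_, rfl⟩ | hx <;> aesop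

theorem nodup_longList_plus : (longList [α, α', β, β', γ] : List (Pt a 1)).Nodup := by
  simp only [up, down, List.nodup_append, List.nodup_ofFn, List.nodup_reverse]
  simp [Function.Injective]
  constructor <;> intro x hx <;> rcases hx with ⟨_, rfl⟩ | hx <;> aesop

theorem orderOf_sMinus : orderOf (sMinus a) = 4 * a + 6 := by
  have := orderOf_formPerm_mul_swap (n := 2 * a + 3) nodup_longList_minus
    (length_longList.trans (by simp; ring)) (by omega) (x := (β' : Pt a 0)) (y := γ)
    (by simp [up, down]) (by simp [up, down]) (by simp)
  rw [sMinus, this]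
  ring

theorem orderOf_sPlus : orderOf (sPlus a) = 4 * a + 8 := by
  have := orderOf_formPerm_mul_swap (n := 2 * a + 4) nodup_longList_plus
    (length_longList.trans (by simp; ring)) (by omega) (x := (γ' : Pt a 1)) (y := ζ 0)
    (by simp [up, down]) (by simp [up, down]) (by simp)
  rw [sPlus, this]
  ring

theorem sign_sMinus : Perm.sign (sMinus a) = 1 :=
  sign_formPerm_mul_swap (n := 2 * a + 3) nodup_longList_minus
    (length_longList.trans (by simp; ring)) (by omega) (by simp)

theorem sign_sPlus : Perm.sign (sPlus a) = 1 :=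
  sign_formPerm_mul_swap (n := 2 * a + 4) nodup_longList_plus
    (length_longList.trans (by simp; ring)) (by omega) (by simp)

theorem formPerm_longList_num (hl : (longList l).Nodup) {j : ℕ} (hj : j + 1 < 2 * a) :
    (longList l).formPerm (num ⟨j, by omega⟩) = num ⟨j + 1, hj⟩ :=
  List.formPerm_of_getElem? hl (getElem?_longList_num ⟨j, by omega⟩)
    (getElem?_longList_num ⟨j + 1, hj⟩)

theorem formPerm_longList_num_last (hl : (longList l).Nodup) (hl0 : 0 < l.length) (ha : 1 ≤ a) :
    (longList l).formPerm (num ⟨2 * a - 1, by omega⟩) = l[0] :=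
  List.formPerm_of_getElem? hl (getElem?_longList_num ⟨2 * a - 1, by omega⟩) (by
    rw [show 2 * a - 1 + 1 = 2 * a + 0 by omega]
    exact getElem?_longList_mid hl0)

theorem formPerm_longList_mid (hl : (longList l).Nodup) {i : ℕ} (hi : i + 1 < l.length) :
    (longList l).formPerm l[i] = l[i + 1] :=
  List.formPerm_of_getElem? hl (getElem?_longList_mid _) (getElem?_longList_mid hi)

theorem formPerm_longList_mid_last (hl : (longList l).Nodup) {i : ℕ} (hi : i + 1 = l.length)
    (ha : 1 ≤ a) : (longList l).formPerm l[i] = num' ⟨2 * a - 1, by omega⟩ :=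
  List.formPerm_of_getElem? hl (getElem?_longList_mid _) (by
    rw [add_assoc, hi]
    exact getElem?_longList_num' (i := 0) (by omega))

theorem formPerm_longList_num' (hl : (longList l).Nodup) {j : ℕ} (hj : j + 1 < 2 * a) :
    (longList l).formPerm (num' ⟨j + 1, hj⟩) = num' ⟨j, by omega⟩ := by
  have h1 := getElem?_longList_num' (l := l) (i := 2 * a - 2 - j) (by omega)
  have h2 := getElem?_longList_num' (l := l) (i := 2 * a - 2 - j + 1) (by omega)
  have e1 : 2 * a - 1 - (2 * a - 2 - j) = j + 1 := by omega
  have e2 : 2 * a - 1 - (2 * a - 2 - j + 1) = j := by omega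
  simp only [e1] at h1
  simp only [e2] at h2
  exact List.formPerm_of_getElem? hl h1 h2

theorem formPerm_longList_num'_zero (hl : (longList l).Nodup) (ha : 1 ≤ a) :
    (longList l).formPerm (num' ⟨0, by omega⟩) = δ := by
  have h1 := getElem?_longList_num' (l := l) (i := 2 * a - 1) (by omega)
  simp only [Nat.sub_self] at h1
  refine List.formPerm_of_getElem? hl h1 ?_
  rw [show 2 * a + l.length + (2 * a - 1) + 1 = 2 * a + l.length + 2 * a + 0 by omega,
    getElem?_longList_end]
  rfl

theorem formPerm_longList_δ (hl : (longList l).Nodup) : (longList l).formPerm δ = ε :=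
  List.formPerm_of_getElem? hl (getElem?_longList_end 0) (getElem?_longList_end 1)

theorem formPerm_longList_ε (hl : (longList l).Nodup) : (longList l).formPerm ε = δ' :=
  List.formPerm_of_getElem? hl (getElem?_longList_end 1) (getElem?_longList_end 2)

theorem formPerm_longList_δ' (hl : (longList l).Nodup) (ha : 1 ≤ a) :
    (longList l).formPerm δ' = num ⟨0, by omega⟩ :=
  List.formPerm_of_getElem?_last hl (getElem?_longList_end 2) (by rw [length_longList]; omega)
    (getElem?_longList_num ⟨0, by omega⟩)

theorem sMinus_apply (ha : 1 ≤ a) (x : Pt a 0) : sMinus a x =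
    match x with
    | num j => if h : j + 1 < 2 * a then num ⟨j + 1, h⟩ else α
    | num' j => if (j : ℕ) = 0 then δ else num' ⟨j - 1, by omega⟩
    | α => α'
    | α' => β
    | β => num' ⟨2 * a - 1, by omega⟩
    | β' => γ
    | γ => β'
    | γ' => γ'
    | δ => ε
    | ε => δ'
    | δ' => num ⟨0, by omega⟩
    | ζ j => ζ j := by
  have hl := nodup_longList_minus (a := a)
  rw [sMinus, Perm.mul_apply]
  cases x with
  | num j =>
    rw [swap_apply_of_ne_of_ne (by simp) (by simp)]
    obtain ⟨j, hj⟩ := j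
    by_cases h : j + 1 < 2 * a
    · simp only [h, dite_true]
      exact formPerm_longList_num hl h
    · simp only [h, dite_false]
      obtain rfl : j = 2 * a - 1 := by omega
      exact formPerm_longList_num_last hl (by simp) ha
  | num' j =>
    rw [swap_apply_of_ne_of_ne (by simp) (by simp)]
    obtain ⟨_ | j, hj⟩ := j
    · exact formPerm_longList_num'_zero hl ha
    · exact formPerm_longList_num' hl hj
  | α =>
    rw [swap_apply_of_ne_of_ne (by simp) (by simp)]
    exact formPerm_longList_mid hl (i := 0) (by simp)
  | α' =>
    rw [swap_apply_of_ne_of_ne (by simp) (by simp)]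
    exact formPerm_longList_mid hl (i := 1) (by simp)
  | β =>
    rw [swap_apply_of_ne_of_ne (by simp) (by simp)]
    exact formPerm_longList_mid_last hl (i := 2) (by simp) ha
  | β' =>
    rw [swap_apply_left]
    exact List.formPerm_apply_of_notMem (by simp [up, down])
  | γ =>
    rw [swap_apply_right]
    exact List.formPerm_apply_of_notMem (by simp [up, down])
  | γ' =>
    rw [swap_apply_of_ne_of_ne (by simp) (by simp)]
    exact List.formPerm_apply_of_notMem (by simp [up, down])
  | δ =>
    rw [swap_apply_of_ne_of_ne (by simp) (by simp)]
    exact formPerm_longList_δ hl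
  | ε =>
    rw [swap_apply_of_ne_of_ne (by simp) (by simp)]
    exact formPerm_longList_ε hl
  | δ' =>
    rw [swap_apply_of_ne_of_ne (by simp) (by simp)]
    exact formPerm_longList_δ' hl ha
  | ζ j => exact j.elim0

theorem sPlus_apply (ha : 1 ≤ a) (x : Pt a 1) : sPlus a x =
    match x with
    | num j => if h : j + 1 < 2 * a then num ⟨j + 1, h⟩ else α
    | num' j => if (j : ℕ) = 0 then δ else num' ⟨j - 1, by omega⟩
    | α => α'
    | α' => β
    | β => β'
    | β' => γ
    | γ => num' ⟨2 * a - 1, by omega⟩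
    | γ' => ζ 0
    | δ => ε
    | ε => δ'
    | δ' => num ⟨0, by omega⟩
    | ζ _ => γ' := by
  have hl := nodup_longList_plus (a := a)
  rw [sPlus, Perm.mul_apply]
  cases x with
  | num j =>
    rw [swap_apply_of_ne_of_ne (by simp) (by simp)]
    obtain ⟨j, hj⟩ := j
    by_cases h : j + 1 < 2 * a
    · simp only [h, dite_true]
      exact formPerm_longList_num hl h
    · simp only [h, dite_false]
      obtain rfl : j = 2 * a - 1 := by omega
      exact formPerm_longList_num_last hl (by simp) ha
  | num' j =>
    rw [swap_apply_of_ne_of_ne (by simp) (by simp)]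
    obtain ⟨_ | j, hj⟩ := j
    · exact formPerm_longList_num'_zero hl ha
    · exact formPerm_longList_num' hl hj
  | α =>
    rw [swap_apply_of_ne_of_ne (by simp) (by simp)]
    exact formPerm_longList_mid hl (i := 0) (by simp)
  | α' =>
    rw [swap_apply_of_ne_of_ne (by simp) (by simp)]
    exact formPerm_longList_mid hl (i := 1) (by simp)
  | β =>
    rw [swap_apply_of_ne_of_ne (by simp) (by simp)]
    exact formPerm_longList_mid hl (i := 2) (by simp)
  | β' =>
    rw [swap_apply_of_ne_of_ne (by simp) (by simp)]
    exact formPerm_longList_mid hl (i := 3) (by simp)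
  | γ =>
    rw [swap_apply_of_ne_of_ne (by simp) (by simp)]
    exact formPerm_longList_mid_last hl (i := 4) (by simp) ha
  | γ' =>
    rw [swap_apply_left]
    exact List.formPerm_apply_of_notMem (by simp [up, down])
  | δ =>
    rw [swap_apply_of_ne_of_ne (by simp) (by simp)]
    exact formPerm_longList_δ hl
  | ε =>
    rw [swap_apply_of_ne_of_ne (by simp) (by simp)]
    exact formPerm_longList_ε hl
  | δ' =>
    rw [swap_apply_of_ne_of_ne (by simp) (by simp)]
    exact formPerm_longList_δ' hl ha
  | ζ j =>
    obtain rfl : j = 0 := Subsingleton.elim _ _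
    rw [swap_apply_right]
    exact List.formPerm_apply_of_notMem (by simp [up, down])

end Pt

/-! ### Short words in the generators, evaluated on ten points -/

theorem viaEmbeddingHom_swap {A B : Type*} [DecidableEq A] [DecidableEq B] (f : A ↪ B) (x y : A) :
    Perm.viaEmbeddingHom f (swap x y) = swap (f x) (f y) := by
  ext z
  rw [Perm.viaEmbeddingHom_apply]
  by_cases hz : z ∈ Set.range f
  · obtain ⟨w, rfl⟩ := hz
    rw [Perm.viaEmbedding_apply, ← f.injective.map_swap]
  · rw [Perm.viaEmbedding_apply_of_notMem _ _ _ hz,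
      swap_apply_of_ne_of_ne (fun h => hz ⟨x, h.symm⟩) (fun h => hz ⟨y, h.symm⟩)]

/-- If `r ^ 2` has order 3 and `r ^ 3` moves a point, then `r` has order 6. -/
theorem orderOf_eq_six {G : Type*} [Group G] {r : G} (h6 : (r ^ 2) ^ 3 = 1) (h2 : r ^ 2 ≠ 1)
    (h3 : r ^ 3 ≠ 1) : orderOf r = 6 := by
  refine orderOf_eq_of_pow_and_pow_div_prime (by norm_num) (by rw [← h6, ← pow_mul]) ?_
  intro p hp hd
  have : p = 2 ∨ p = 3 := by
    have h := (Nat.Prime.dvd_mul hp).1 (show p ∣ 2 * 3 from hd)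
    rwa [Nat.prime_dvd_prime_iff_eq hp Nat.prime_two,
      Nat.prime_dvd_prime_iff_eq hp Nat.prime_three] at h
  rcases this with rfl | rfl
  exacts [h3, h2]

/-- Conjugation by y² turns the word at the inverses into one in the same u and v, so the conjugate
of x² by y⁻² need not be computed. -/
theorem chiralWord_inv_eq_one_iff {G : Type*} [Group G] {m : ℕ} {x y u v : G} (hu : x ^ 2 = u)
    (hv : y ^ 2 * u * (y ^ 2)⁻¹ = v) :
    chiralWord m x⁻¹ y⁻¹ = 1 ↔ (v⁻¹ * u⁻¹ * v⁻¹ * u) ^ m = 1 := by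
  have h : chiralWord m x⁻¹ y⁻¹ =
      ((y ^ 2)⁻¹ * (v⁻¹ * u⁻¹ * v⁻¹ * u) * ((y ^ 2)⁻¹)⁻¹) ^ m := by
    rw [chiralWord, ← hv]
    simp only [inv_pow, hu]
    generalize y ^ 2 = w
    congr 1
    group
  rw [h, conj_pow, conj_eq_one_iff]

namespace Pt

variable {a : ℕ}

theorem rMinus_apply (ha : 1 ≤ a) (x : Pt a 0) : rMinus a x =
    match x with
    | num j => if h : j + 1 < 2 * a then num' ⟨j + 1, h⟩ else β
    | num' j => if (j : ℕ) = 0 then δ' else num ⟨j - 1, by omega⟩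
    | α => α
    | α' => num ⟨2 * a - 1, by omega⟩
    | β => γ
    | β' => α'
    | γ => γ'
    | γ' => β'
    | δ => ε
    | ε => δ
    | δ' => num' ⟨0, by omega⟩
    | ζ j => ζ j := by
  rw [rMinus, Perm.mul_apply, Perm.inv_eq_iff_eq, t_apply, sMinus_apply ha]
  cases x with
  | num j =>
    by_cases h : (j : ℕ) + 1 < 2 * a
    · simp [h]
    · simp only [h, dite_false]
      congr 1; ext; simp; omega
  | num' j =>
    by_cases h : (j : ℕ) = 0
    · simp only [h, if_true]
      congr 1; ext; simp; omega
    · have h1 : (j : ℕ) - 1 + 1 = j := by omega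
      simp [h, h1]
  | α' =>
    have : ¬ (2 * a - 1 + 1 < 2 * a) := by omega
    simp [this]
  | _ => simp

theorem rPlus_apply (ha : 1 ≤ a) (x : Pt a 1) : rPlus a x =
    match x with
    | num j => if h : j + 1 < 2 * a then num' ⟨j + 1, h⟩ else γ
    | num' j => if (j : ℕ) = 0 then δ' else num ⟨j - 1, by omega⟩
    | α => α
    | α' => num ⟨2 * a - 1, by omega⟩
    | β => β
    | β' => α'
    | γ => ζ 0
    | γ' => β'
    | δ => ε
    | ε => δ
    | δ' => num' ⟨0, by omega⟩
    | ζ _ => γ' := by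
  rw [rPlus, Perm.mul_apply, Perm.inv_eq_iff_eq, t_apply, sPlus_apply ha]
  cases x with
  | num j =>
    by_cases h : (j : ℕ) + 1 < 2 * a
    · simp [h]
    · simp only [h, dite_false]
      congr 1; ext; simp; omega
  | num' j =>
    by_cases h : (j : ℕ) = 0
    · simp only [h, if_true]
      congr 1; ext; simp; omega
    · have h1 : (j : ℕ) - 1 + 1 = j := by omega
      simp [h, h1]
  | α' =>
    have : ¬ (2 * a - 1 + 1 < 2 * a) := by omega
    simp [this]
  | ζ j => simp [Subsingleton.elim j 0]
  | _ => simp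

/-- A product `swap x y * swap y z` of distinct points is the 3-cycle x → y → z → x. All remaining
cycles of `r` have length 1 or 2 and vanish in the square. -/
theorem rMinus_sq (ha : 1 ≤ a) : rMinus a ^ 2 =
    swap (num ⟨2 * a - 1, by omega⟩) γ * swap γ β' * (swap α' β * swap β γ') := by
  ext x
  rw [pow_two, Perm.mul_apply, rMinus_apply ha, rMinus_apply ha]
  have h0 : 2 * a - 1 + 1 = 2 * a := by omega
  cases x with
  | num j =>
    by_cases h : (j : ℕ) + 1 < 2 * a
    · have : j ≠ ⟨2 * a - 1, by omega⟩ := fun h' => by simp [h'] at h; omega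
      simp [h, swap_apply_def, this]
    · have hj : j = ⟨2 * a - 1, by omega⟩ := Fin.ext (by simp; omega)
      simp [swap_apply_def, h0, hj]
  | num' j =>
    by_cases h : (j : ℕ) = 0
    · simp only [h, if_true]
      simp [swap_apply_def, Fin.ext_iff, h]
    · have h1 : (j : ℕ) - 1 + 1 = j := by omega
      simp [h, h1, swap_apply_def]
  | _ => simp [swap_apply_def, h0]

theorem rPlus_sq (ha : 1 ≤ a) : rPlus a ^ 2 =
    swap (num ⟨2 * a - 1, by omega⟩) (ζ 0) * swap (ζ 0) β' * (swap α' γ * swap γ γ') := by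
  ext x
  rw [pow_two, Perm.mul_apply, rPlus_apply ha, rPlus_apply ha]
  have h0 : 2 * a - 1 + 1 = 2 * a := by omega
  cases x with
  | num j =>
    by_cases h : (j : ℕ) + 1 < 2 * a
    · have : j ≠ ⟨2 * a - 1, by omega⟩ := fun h' => by simp [h'] at h; omega
      simp [h, swap_apply_def, this]
    · have hj : j = ⟨2 * a - 1, by omega⟩ := Fin.ext (by simp; omega)
      simp [swap_apply_def, h0, hj]
  | num' j =>
    by_cases h : (j : ℕ) = 0
    · simp only [h, if_true]
      simp [swap_apply_def, Fin.ext_iff, h]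
    · have h1 : (j : ℕ) - 1 + 1 = j := by omega
      simp [h, h1, swap_apply_def]
  | ζ j => simp [swap_apply_def, Subsingleton.elim j 0]
  | _ => simp [swap_apply_def, h0]

theorem rMinus_pow_three_ne_one (ha : 1 ≤ a) : rMinus a ^ 3 ≠ 1 := fun h => by
  have := Equiv.congr_fun h δ
  simp [pow_succ, rMinus_apply ha] at this

theorem rPlus_pow_three_ne_one (ha : 1 ≤ a) : rPlus a ^ 3 ≠ 1 := fun h => by
  have := Equiv.congr_fun h δ
  simp [pow_succ, rPlus_apply ha] at this

/-- The points moved by certain short words in the generators. -/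
def coreMinus (ha : 1 ≤ a) : Fin 10 ↪ Pt a 0 where
  toFun := ![num ⟨2 * a - 1, by omega⟩, num ⟨2 * a - 2, by omega⟩, num' ⟨2 * a - 1, by omega⟩,
    num' ⟨2 * a - 2, by omega⟩, α, α', β, β', γ, γ']
  inj' i j h := by
    fin_cases i <;> fin_cases j <;> simp at h ⊢ <;> omega

/-- The points moved by certain short words in the generators. -/
def corePlus (ha : 1 ≤ a) : Fin 10 ↪ Pt a 1 where
  toFun := ![num ⟨2 * a - 1, by omega⟩, ζ 0, num' ⟨2 * a - 1, by omega⟩,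
    num' ⟨2 * a - 2, by omega⟩, α, α', β, β', γ, γ']
  inj' i j h := by
    fin_cases i <;> fin_cases j <;> simp at h ⊢ <;> omega

theorem coreMinus_apply (ha : 1 ≤ a) (i : Fin 10) : coreMinus ha i =
    ![num ⟨2 * a - 1, by omega⟩, num ⟨2 * a - 2, by omega⟩, num' ⟨2 * a - 1, by omega⟩,
      num' ⟨2 * a - 2, by omega⟩, α, α', β, β', γ, γ'] i := rfl

theorem corePlus_apply (ha : 1 ≤ a) (i : Fin 10) : corePlus ha i =
    ![num ⟨2 * a - 1, by omega⟩, ζ 0, num' ⟨2 * a - 1, by omega⟩,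
      num' ⟨2 * a - 2, by omega⟩, α, α', β, β', γ, γ'] i := rfl

/-- Extension of a permutation of the core. -/
noncomputable abbrev extMinus (ha : 1 ≤ a) : Perm (Fin 10) →* Perm (Pt a 0) :=
  Perm.viaEmbeddingHom (coreMinus ha)

/-- Extension of a permutation of the core. -/
noncomputable abbrev extPlus (ha : 1 ≤ a) : Perm (Fin 10) →* Perm (Pt a 1) :=
  Perm.viaEmbeddingHom (corePlus ha)

/-- The square of `rMinus` on the core. -/
abbrev uMinus : Perm (Fin 10) := swap 0 8 * swap 8 7 * (swap 5 6 * swap 6 9)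

/-- The conjugate of `uMinus` by the square of `sMinus`. -/
abbrev vMinus : Perm (Fin 10) := swap 5 8 * swap 8 7 * (swap 2 3 * swap 3 9)

/-- The square of `rPlus` on the core. -/
abbrev uPlus : Perm (Fin 10) := swap 0 1 * swap 1 7 * (swap 5 8 * swap 8 9)

/-- The conjugate of `uPlus` by the square of `sPlus`. -/
abbrev vPlus : Perm (Fin 10) := swap 5 1 * swap 1 2 * (swap 7 3 * swap 3 9)

theorem rMinus_sq_eq_ext (ha : 1 ≤ a) : rMinus a ^ 2 = extMinus ha uMinus := by
  simp only [rMinus_sq ha, map_mul, viaEmbeddingHom_swap]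
  rfl

theorem rPlus_sq_eq_ext (ha : 1 ≤ a) : rPlus a ^ 2 = extPlus ha uPlus := by
  simp only [rPlus_sq ha, map_mul, viaEmbeddingHom_swap]
  rfl

/-- Conjugation relabels the entries of a cycle, so only the images of six points under `f` are
needed, although `f` need not preserve the ten core points. -/
theorem conj_mul_swaps {A : Type*} [DecidableEq A] (f : Perm A) (x y z u v w : A) :
    f * (swap x y * swap y z * (swap u v * swap v w)) * f⁻¹ =
      swap (f x) (f y) * swap (f y) (f z) * (swap (f u) (f v) * swap (f v) (f w)) := by
  simp only [swap_apply_apply]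
  group

theorem sMinus_sq_conj (ha : 1 ≤ a) :
    sMinus a ^ 2 * extMinus ha uMinus * (sMinus a ^ 2)⁻¹ = extMinus ha vMinus := by
  have h0 : ¬ (2 * a - 1 + 1 < 2 * a) := by omega
  have h1 : 2 * a - 1 ≠ 0 := by omega
  have h2 : 2 * a - 1 - 1 = 2 * a - 2 := by omega
  simp only [map_mul, viaEmbeddingHom_swap, conj_mul_swaps]
  simp [coreMinus_apply, pow_two, sMinus_apply ha, h0, h1, h2]

theorem sPlus_sq_conj (ha : 1 ≤ a) :
    sPlus a ^ 2 * extPlus ha uPlus * (sPlus a ^ 2)⁻¹ = extPlus ha vPlus := by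
  have h0 : ¬ (2 * a - 1 + 1 < 2 * a) := by omega
  have h1 : 2 * a - 1 ≠ 0 := by omega
  have h2 : 2 * a - 1 - 1 = 2 * a - 2 := by omega
  simp only [map_mul, viaEmbeddingHom_swap, conj_mul_swaps]
  simp [corePlus_apply, pow_two, sPlus_apply ha, h0, h1, h2]

set_option maxRecDepth 100000 in
theorem chiralWord_minus (ha : 1 ≤ a) : chiralWord 3 (rMinus a) (sMinus a) = 1 := by
  -- The base is a product of two disjoint 3-cycles.
  have h : (uMinus * vMinus * uMinus * vMinus⁻¹) ^ 3 = 1 := by decide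
  rw [chiralWord, rMinus_sq_eq_ext ha, sMinus_sq_conj ha, ← map_inv]
  simp only [← map_mul, ← map_pow, h, map_one]

set_option maxRecDepth 100000 in
theorem chiralWord_plus (ha : 1 ≤ a) : chiralWord 7 (rPlus a) (sPlus a) = 1 := by
  -- The base is a 7-cycle.
  have h : (uPlus * vPlus * uPlus * vPlus⁻¹) ^ 7 = 1 := by decide
  rw [chiralWord, rPlus_sq_eq_ext ha, sPlus_sq_conj ha, ← map_inv]
  simp only [← map_mul, ← map_pow, h, map_one]

set_option maxRecDepth 100000 in
theorem chiralWord_minus_inv (ha : 1 ≤ a) : chiralWord 3 (rMinus a)⁻¹ (sMinus a)⁻¹ ≠ 1 := by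
  -- Here the base is a 6-cycle times a disjoint transposition.
  have h : (vMinus⁻¹ * uMinus⁻¹ * vMinus⁻¹ * uMinus) ^ 3 ≠ 1 := by decide
  rw [Ne, chiralWord_inv_eq_one_iff (rMinus_sq_eq_ext ha) (sMinus_sq_conj ha), ← map_inv,
    ← map_inv]
  simpa only [← map_mul, ← map_pow, map_eq_one_iff _ (Perm.viaEmbeddingHom_injective _)] using h

set_option maxRecDepth 100000 in
theorem chiralWord_plus_inv (ha : 1 ≤ a) : chiralWord 7 (rPlus a)⁻¹ (sPlus a)⁻¹ ≠ 1 := by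
  -- Here the base is a product of two disjoint 4-cycles.
  have h : (vPlus⁻¹ * uPlus⁻¹ * vPlus⁻¹ * uPlus) ^ 7 ≠ 1 := by decide
  rw [Ne, chiralWord_inv_eq_one_iff (rPlus_sq_eq_ext ha) (sPlus_sq_conj ha), ← map_inv,
    ← map_inv]
  simpa only [← map_mul, ← map_pow, map_eq_one_iff _ (Perm.viaEmbeddingHom_injective _)] using h

theorem orderOf_rMinus (ha : 1 ≤ a) : orderOf (rMinus a) = 6 := by
  have h1 : uMinus ^ 3 = 1 := by decide
  have h2 : uMinus ≠ 1 := by decide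
  refine orderOf_eq_six ?_ ?_ (rMinus_pow_three_ne_one ha) <;> rw [rMinus_sq_eq_ext ha]
  · rw [← map_pow, h1, map_one]
  · rwa [Ne, map_eq_one_iff _ (Perm.viaEmbeddingHom_injective _)]

theorem orderOf_rPlus (ha : 1 ≤ a) : orderOf (rPlus a) = 6 := by
  have h1 : uPlus ^ 3 = 1 := by decide
  have h2 : uPlus ≠ 1 := by decide
  refine orderOf_eq_six ?_ ?_ (rPlus_pow_three_ne_one ha) <;> rw [rPlus_sq_eq_ext ha]
  · rw [← map_pow, h1, map_one]
  · rwa [Ne, map_eq_one_iff _ (Perm.viaEmbeddingHom_injective _)]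

/-! ### Three-cycles in G -/

theorem isThreeCycle_ext {a e : ℕ} (f : Fin 10 ↪ Pt a e) {x y z : Fin 10} (hxy : x ≠ y)
    (hxz : x ≠ z) (hyz : y ≠ z) : (Perm.viaEmbeddingHom f (swap x y * swap x z)).IsThreeCycle := by
  rw [map_mul, viaEmbeddingHom_swap, viaEmbeddingHom_swap]
  exact Perm.isThreeCycle_swap_mul_swap_same (f.injective.ne hxy) (f.injective.ne hxz)
    (f.injective.ne hyz)

set_option maxRecDepth 100000 in
theorem exists_isThreeCycle_plus (ha : 1 ≤ a) :
    ∃ g ∈ rotGroup (rPlus a) (sPlus a), g.IsThreeCycle := by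
  have hr : rPlus a ∈ rotGroup (rPlus a) (sPlus a) := Subgroup.subset_closure (by simp)
  have hs : sPlus a ∈ rotGroup (rPlus a) (sPlus a) := Subgroup.subset_closure (by simp)
  have h0 : ¬ (2 * a - 1 + 1 < 2 * a) := by omega
  set u' : Perm (Fin 10) := swap 4 9 * swap 9 8 * (swap 6 2 * swap 2 1)
  have hu' : sPlus a * rPlus a ^ 2 * (sPlus a)⁻¹ = extPlus ha u' := by
    rw [rPlus_sq_eq_ext ha]
    simp only [u', map_mul, viaEmbeddingHom_swap, conj_mul_swaps]
    simp [corePlus_apply, sPlus_apply ha, h0]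
  refine ⟨(sPlus a * rPlus a ^ 2 * (sPlus a)⁻¹ * rPlus a ^ 2) ^ 5,
    pow_mem (mul_mem (mul_mem (mul_mem hs (pow_mem hr 2)) (inv_mem hs)) (pow_mem hr 2)) 5, ?_⟩
  -- The product is a 5-cycle times a disjoint 3-cycle; the fifth power removes the former.
  have h : (u' * uPlus) ^ 5 = swap 4 9 * swap 4 5 := by decide
  rw [hu', rPlus_sq_eq_ext ha, ← map_mul, ← map_pow, h]
  exact isThreeCycle_ext _ (by decide) (by decide) (by decide)

set_option maxRecDepth 100000 in
theorem exists_isThreeCycle_minus (ha : 1 ≤ a) :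
    ∃ g ∈ rotGroup (rMinus a) (sMinus a), g.IsThreeCycle := by
  have hr : rMinus a ∈ rotGroup (rMinus a) (sMinus a) := Subgroup.subset_closure (by simp)
  have hs : sMinus a ∈ rotGroup (rMinus a) (sMinus a) := Subgroup.subset_closure (by simp)
  have ht : t a 0 ∈ rotGroup (rMinus a) (sMinus a) := by
    simpa [rMinus] using mul_mem hs hr
  have h0 : ¬ (2 * a - 1 + 1 < 2 * a) := by omega
  have h1 : 0 < a := ha
  have h2 : 2 * a - 2 + 1 = 2 * a - 1 := by omega
  set u' : Perm (Fin 10) := swap 1 7 * swap 7 8 * (swap 4 5 * swap 5 9)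
  set u'' : Perm (Fin 10) := swap 3 6 * swap 6 9 * (swap 5 4 * swap 4 8)
  have hu' : (sMinus a)⁻¹ * rMinus a ^ 2 * sMinus a = extMinus ha u' := by
    have : rMinus a ^ 2 = sMinus a * extMinus ha u' * (sMinus a)⁻¹ := by
      rw [rMinus_sq_eq_ext ha]
      simp only [u', map_mul, viaEmbeddingHom_swap, conj_mul_swaps]
      simp [coreMinus_apply, sMinus_apply ha, h1, h2]
    rw [this]; group
  have hu'' : t a 0 * extMinus ha u' * (t a 0)⁻¹ = extMinus ha u'' := by
    simp only [u', u'', map_mul, viaEmbeddingHom_swap, conj_mul_swaps]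
    simp [coreMinus_apply, t_apply]
  have hm' : extMinus ha u' ∈ rotGroup (rMinus a) (sMinus a) :=
    hu' ▸ mul_mem (mul_mem (inv_mem hs) (pow_mem hr 2)) hs
  have hm'' : extMinus ha u'' ∈ rotGroup (rMinus a) (sMinus a) :=
    hu'' ▸ mul_mem (mul_mem ht hm') (inv_mem ht)
  have hm : extMinus ha uMinus ∈ rotGroup (rMinus a) (sMinus a) :=
    rMinus_sq_eq_ext ha ▸ pow_mem hr 2
  refine ⟨(extMinus ha u'⁻¹ * extMinus ha u'' * extMinus ha uMinus) ^ 2,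
    pow_mem (mul_mem (mul_mem ((map_inv (extMinus ha) u').symm ▸ inv_mem hm') hm'') hm) 2, ?_⟩
  -- The product is a 3-cycle times two transpositions, all disjoint; squaring leaves a 3-cycle.
  have h : (u'⁻¹ * u'' * uMinus) ^ 2 = swap 0 4 * swap 0 7 := by decide
  rw [← map_mul, ← map_mul, ← map_pow, h]
  exact isThreeCycle_ext _ (by decide) (by decide) (by decide)

end Pt

/-! ### Blocks, transitivity and primitivity -/

/-- Invariance under s² makes membership constant on points an even number of steps apart; the one
odd step at `y` joins the two parities. -/
theorem mem_iff_of_sameCycle {Ω : Type*} {s : Perm Ω} {B : Set Ω} {x y : Ω}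
    (h₂ : ∀ z, s (s z) ∈ B ↔ z ∈ B) (h₁ : s y ∈ B ↔ y ∈ B) (h : s.SameCycle y x) :
    x ∈ B ↔ y ∈ B := by
  have h2i (z : Ω) (k : ℤ) : ((s * s) ^ k) z ∈ B ↔ z ∈ B := by
    induction k with
    | zero => simp
    | succ n ih =>
      rw [add_comm, zpow_add, Perm.mul_apply, zpow_one, Perm.mul_apply, h₂, ih]
    | pred n ih =>
      rw [← ih, sub_eq_neg_add, zpow_add, zpow_neg_one, Perm.mul_apply, ← h₂, ← Perm.mul_apply s s,
        ← Perm.mul_apply (s * s), mul_inv_cancel, Perm.one_apply]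
  obtain ⟨i, rfl⟩ := h
  obtain ⟨k, rfl | rfl⟩ := Int.even_or_odd' i
  · rw [zpow_mul, zpow_two, h2i]
  · rw [zpow_add, zpow_mul, zpow_two, zpow_one, Perm.mul_apply, h2i, h₁]

open scoped Pointwise in
-- A block that meets its translate coincides with it.
theorem MulAction.IsBlock.apply_mem_iff {Ω : Type*} {G : Subgroup (Perm Ω)} {B : Set Ω}
    (hB : MulAction.IsBlock G B) {g : Perm Ω} (hg : g ∈ G) {b : Ω} (hb : b ∈ B) (hgb : g b ∈ B)
    (x : Ω) : g x ∈ B ↔ x ∈ B := by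
  have h : (⟨g, hg⟩ : G) • B = B := hB.smul_eq_of_mem (g := ⟨g, hg⟩) hb hgb
  constructor
  · intro hx
    rw [← h] at hx
    obtain ⟨y, hy, hyx⟩ := hx
    rwa [← g.injective hyx]
  · intro hx
    rw [← h]
    exact ⟨x, hx, rfl⟩

namespace Pt

variable {a e : ℕ}

/-- The cycle of a permutation that descends through `2a', …, 1'`, passes through `δ, ε, δ'` and
ascends through `1, …, 2a` contains all these points. -/
theorem sameCycle_of_steps (ha : 1 ≤ a) {s : Perm (Pt a e)} {x : Pt a e}
    (h0 : s.SameCycle x (num' ⟨2 * a - 1, by omega⟩))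
    (hnum' : ∀ j (hj : j + 1 < 2 * a), s (num' ⟨j + 1, hj⟩) = num' ⟨j, by omega⟩)
    (hz : s (num' ⟨0, by omega⟩) = δ) (hδ : s δ = ε) (hε : s ε = δ')
    (hδ' : s δ' = num ⟨0, by omega⟩)
    (hnum : ∀ j (hj : j + 1 < 2 * a), s (num ⟨j, by omega⟩) = num ⟨j + 1, hj⟩) :
    (∀ j, s.SameCycle x (num' j)) ∧ s.SameCycle x δ ∧ s.SameCycle x ε ∧ s.SameCycle x δ' ∧
      ∀ j, s.SameCycle x (num j) := by
  have step {y z : Pt a e} (hy : s.SameCycle x y) (hyz : s y = z) : s.SameCycle x z :=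
    hyz ▸ Perm.sameCycle_apply_right.2 hy
  have h1 (i : ℕ) (hi : i < 2 * a) : s.SameCycle x (num' ⟨2 * a - 1 - i, by omega⟩) := by
    induction i with
    | zero => exact h0
    | succ i ih =>
      refine step (ih (by omega)) ?_
      rw [← hnum' (2 * a - 1 - (i + 1)) (by omega)]
      congr 3
      omega
  have h2 (j : Fin (2 * a)) : s.SameCycle x (num' j) := by
    have := h1 (2 * a - 1 - j) (by omega)
    convert this using 3
    omega
  have h3 := step (h2 _) hz
  have h4 := step h3 hδ
  have h5 := step h4 hε
  refine ⟨h2, h3, h4, h5, ?_⟩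
  rintro ⟨j, hj⟩
  induction j with
  | zero => exact step h5 hδ'
  | succ j ih => exact step (ih (by omega)) (hnum j hj)

theorem sameCycle_sMinus (ha : 1 ≤ a) {x : Pt a 0} (h1 : x ≠ β') (h2 : x ≠ γ) (h3 : x ≠ γ') :
    (sMinus a).SameCycle α x := by
  have step {y z : Pt a 0} (hy : (sMinus a).SameCycle α y) (hyz : sMinus a y = z) :
      (sMinus a).SameCycle α z := hyz ▸ Perm.sameCycle_apply_right.2 hy
  have hα' := step (Perm.SameCycle.refl _ α) (sMinus_apply ha α)
  have hβ := step hα' (sMinus_apply ha α')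
  obtain ⟨hnum', hδ, hε, hδ', hnum⟩ := sameCycle_of_steps ha (step hβ (sMinus_apply ha β))
    (fun j hj => by simp [sMinus_apply ha]) (by simp [sMinus_apply ha]) (sMinus_apply ha δ)
    (sMinus_apply ha ε) (sMinus_apply ha δ') (fun j hj => by simp [sMinus_apply ha, hj])
  cases x with
  | num j => exact hnum j
  | num' j => exact hnum' j
  | ζ j => exact j.elim0
  | α => exact Perm.SameCycle.refl _ _
  | _ => first | assumption | contradiction

theorem sameCycle_sPlus (ha : 1 ≤ a) {x : Pt a 1} (h1 : x ≠ γ') (h2 : x ≠ ζ 0) :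
    (sPlus a).SameCycle α x := by
  have step {y z : Pt a 1} (hy : (sPlus a).SameCycle α y) (hyz : sPlus a y = z) :
      (sPlus a).SameCycle α z := hyz ▸ Perm.sameCycle_apply_right.2 hy
  have hα' := step (Perm.SameCycle.refl _ α) (sPlus_apply ha α)
  have hβ := step hα' (sPlus_apply ha α')
  have hβ' := step hβ (sPlus_apply ha β)
  have hγ := step hβ' (sPlus_apply ha β')
  obtain ⟨hnum', hδ, hε, hδ', hnum⟩ := sameCycle_of_steps ha (step hγ (sPlus_apply ha γ))
    (fun j hj => by simp [sPlus_apply ha]) (by simp [sPlus_apply ha]) (sPlus_apply ha δ)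
    (sPlus_apply ha ε) (sPlus_apply ha δ') (fun j hj => by simp [sPlus_apply ha, hj])
  cases x with
  | num j => exact hnum j
  | num' j => exact hnum' j
  | ζ j => exact absurd (congrArg ζ (Subsingleton.elim j 0)) h2
  | α => exact Perm.SameCycle.refl _ _
  | _ => first | assumption | contradiction

theorem mem_rotGroup (s : Perm (Pt a e)) :
    s ∈ rotGroup (s⁻¹ * t a e) s ∧ t a e ∈ rotGroup (s⁻¹ * t a e) s := by
  have hr : s⁻¹ * t a e ∈ rotGroup (s⁻¹ * t a e) s := Subgroup.subset_closure (by simp)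
  have hs : s ∈ rotGroup (s⁻¹ * t a e) s := Subgroup.subset_closure (by simp)
  exact ⟨hs, by simpa using mul_mem hs hr⟩

theorem isPretransitive_minus (ha : 1 ≤ a) :
    MulAction.IsPretransitive (rotGroup (rMinus a) (sMinus a)) (Pt a 0) := by
  obtain ⟨hs, ht⟩ := mem_rotGroup (sMinus a)
  have hlong {x : Pt a 0} (h : (sMinus a).SameCycle α x) :
      ∃ g ∈ rotGroup (rMinus a) (sMinus a), g α = x := by
    obtain ⟨i, hi⟩ := h
    exact ⟨_, zpow_mem hs i, hi⟩
  -- The points off the long cycle are reached along β → β' → γ → γ', by t, s and t in turn.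
  have hβ' : ∃ g ∈ rotGroup (rMinus a) (sMinus a), g α = β' := by
    obtain ⟨g, hg, h⟩ := hlong (sameCycle_sMinus ha (x := β) (by simp) (by simp) (by simp))
    exact ⟨t a 0 * g, mul_mem ht hg, by rw [Perm.mul_apply, h, t_apply]⟩
  have hγ : ∃ g ∈ rotGroup (rMinus a) (sMinus a), g α = γ := by
    obtain ⟨g, hg, h⟩ := hβ'
    exact ⟨sMinus a * g, mul_mem hs hg, by rw [Perm.mul_apply, h, sMinus_apply ha]⟩
  have hγ' : ∃ g ∈ rotGroup (rMinus a) (sMinus a), g α = γ' := by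
    obtain ⟨g, hg, h⟩ := hγ
    exact ⟨t a 0 * g, mul_mem ht hg, by rw [Perm.mul_apply, h, t_apply]⟩
  refine (MulAction.isPretransitive_iff_base α).2 fun x => ?_
  suffices h : ∃ g ∈ rotGroup (rMinus a) (sMinus a), g α = x by
    obtain ⟨g, hg, h⟩ := h
    exact ⟨⟨g, hg⟩, h⟩
  by_cases h1 : x = β'
  · exact h1 ▸ hβ'
  by_cases h2 : x = γ
  · exact h2 ▸ hγ
  by_cases h3 : x = γ'
  · exact h3 ▸ hγ'
  exact hlong (sameCycle_sMinus ha h1 h2 h3)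

theorem isPretransitive_plus (ha : 1 ≤ a) :
    MulAction.IsPretransitive (rotGroup (rPlus a) (sPlus a)) (Pt a 1) := by
  obtain ⟨hs, ht⟩ := mem_rotGroup (sPlus a)
  have hlong {x : Pt a 1} (h : (sPlus a).SameCycle α x) :
      ∃ g ∈ rotGroup (rPlus a) (sPlus a), g α = x := by
    obtain ⟨i, hi⟩ := h
    exact ⟨_, zpow_mem hs i, hi⟩
  have hγ' : ∃ g ∈ rotGroup (rPlus a) (sPlus a), g α = γ' := by
    obtain ⟨g, hg, h⟩ := hlong (sameCycle_sPlus ha (x := γ) (by simp) (by simp))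
    exact ⟨t a 1 * g, mul_mem ht hg, by rw [Perm.mul_apply, h, t_apply]⟩
  have hζ : ∃ g ∈ rotGroup (rPlus a) (sPlus a), g α = ζ 0 := by
    obtain ⟨g, hg, h⟩ := hγ'
    exact ⟨sPlus a * g, mul_mem hs hg, by rw [Perm.mul_apply, h, sPlus_apply ha]⟩
  refine (MulAction.isPretransitive_iff_base α).2 fun x => ?_
  suffices h : ∃ g ∈ rotGroup (rPlus a) (sPlus a), g α = x by
    obtain ⟨g, hg, h⟩ := h
    exact ⟨⟨g, hg⟩, h⟩
  by_cases h1 : x = γ'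
  · exact h1 ▸ hγ'
  by_cases h2 : x = ζ 0
  · exact h2 ▸ hζ
  exact hlong (sameCycle_sPlus ha h1 h2)

theorem isPreprimitive_minus (ha : 1 ≤ a) :
    MulAction.IsPreprimitive (rotGroup (rMinus a) (sMinus a)) (Pt a 0) := by
  obtain ⟨hs, ht⟩ := mem_rotGroup (sMinus a)
  have := isPretransitive_minus ha
  -- The base point γ' is fixed by `s`, so a block through it is a union of cycles of `s`: the long
  -- one, {β', γ} and {γ'}.
  refine MulAction.IsPreprimitive.of_isTrivialBlock_base γ' fun {B} hγ' hB => ?_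
  have hsB (x : Pt a 0) : sMinus a x ∈ B ↔ x ∈ B :=
    hB.apply_mem_iff hs hγ' (by rwa [sMinus_apply ha]) x
  have hlong {x : Pt a 0} (h1 : x ≠ β') (h2 : x ≠ γ) (h3 : x ≠ γ') : x ∈ B ↔ α ∈ B :=
    mem_iff_of_sameCycle (fun z => by rw [hsB, hsB]) (hsB α) (sameCycle_sMinus ha h1 h2 h3)
  have hγ : γ ∈ B ↔ β' ∈ B := by rw [← hsB β', sMinus_apply ha]
  by_cases hα : α ∈ B
  · right
    have htB (x : Pt a 0) : t a 0 x ∈ B ↔ x ∈ B :=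
      hB.apply_mem_iff ht hα (by simpa [t_apply] using (hlong (by simp) (by simp) (by simp)).2 hα) x
    have hβ' : β' ∈ B := by
      have := (htB β).2 ((hlong (by simp) (by simp) (by simp)).2 hα)
      rwa [t_apply] at this
    refine Set.eq_univ_of_forall fun x => ?_
    by_cases h1 : x = β'
    · exact h1 ▸ hβ'
    by_cases h2 : x = γ
    · exact h2 ▸ hγ.2 hβ'
    by_cases h3 : x = γ'
    · exact h3 ▸ hγ'
    exact (hlong h1 h2 h3).2 hα
  · left
    have hβ' : β' ∉ B := fun h => by
      have htB := hB.apply_mem_iff ht hγ' (by rw [t_apply]; exact hγ.2 h) β'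
      rw [t_apply] at htB
      exact hα ((hlong (by simp) (by simp) (by simp)).1 (htB.2 h))
    have huniq {x : Pt a 0} (hx : x ∈ B) : x = γ' := by
      by_contra h3
      refine hα ((hlong ?_ ?_ h3).1 hx)
      · rintro rfl; exact hβ' hx
      · rintro rfl; exact hβ' (hγ.1 hx)
    exact fun x hx y hy => (huniq hx).trans (huniq hy).symm

theorem isPreprimitive_plus (ha : 1 ≤ a) :
    MulAction.IsPreprimitive (rotGroup (rPlus a) (sPlus a)) (Pt a 1) := by
  obtain ⟨hs, ht⟩ := mem_rotGroup (sPlus a)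
  have := isPretransitive_plus ha
  -- The base point ζ is fixed by `t` and by s², so both preserve a block through it.
  refine MulAction.IsPreprimitive.of_isTrivialBlock_base (ζ 0) fun {B} hζ hB => ?_
  have htB (x : Pt a 1) : t a 1 x ∈ B ↔ x ∈ B := hB.apply_mem_iff ht hζ (by rwa [t_apply]) x
  have hsB (x : Pt a 1) : sPlus a (sPlus a x) ∈ B ↔ x ∈ B :=
    hB.apply_mem_iff (mul_mem hs hs) hζ (by
      rw [Perm.mul_apply, sPlus_apply ha, sPlus_apply ha]; exact hζ) x
  -- At α the permutations `s` and `t` agree, which supplies the odd step along the long cycle.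
  have hsα : sPlus a α ∈ B ↔ α ∈ B := by rw [← htB α, t_apply, sPlus_apply ha]
  have hlong {x : Pt a 1} (h1 : x ≠ γ') (h2 : x ≠ ζ 0) : x ∈ B ↔ α ∈ B :=
    mem_iff_of_sameCycle hsB hsα (sameCycle_sPlus ha h1 h2)
  have hγ' : γ' ∈ B ↔ α ∈ B := by
    rw [← hlong (x := γ) (by simp) (by simp), ← htB γ, t_apply]
  by_cases hα : α ∈ B
  · right
    refine Set.eq_univ_of_forall fun x => ?_
    by_cases h1 : x = γ'
    · exact h1 ▸ hγ'.2 hα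
    by_cases h2 : x = ζ 0
    · exact h2 ▸ hζ
    exact (hlong h1 h2).2 hα
  · left
    have huniq {x : Pt a 1} (hx : x ∈ B) : x = ζ 0 := by
      by_contra h2
      refine hα ((hlong ?_ h2).1 hx)
      rintro rfl
      exact hα (hγ'.1 hx)
    exact fun x hx y hy => (huniq hx).trans (huniq hy).symm

/-! ### Identification with the alternating group and conclusion -/

theorem rotGroup_le_alternatingGroup {s : Perm (Pt a e)} (hs : Perm.sign s = 1) :
    rotGroup (s⁻¹ * t a e) s ≤ alternatingGroup (Pt a e) := by
  rw [rotGroup, Subgroup.closure_le]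
  rintro g (rfl | rfl)
  · simp [Perm.mem_alternatingGroup, hs, sign_t]
  · exact Perm.mem_alternatingGroup.2 hs

theorem rotGroup_minus (ha : 1 ≤ a) :
    rotGroup (rMinus a) (sMinus a) = alternatingGroup (Pt a 0) := by
  obtain ⟨g, hg, h⟩ := exists_isThreeCycle_minus ha
  exact le_antisymm (rotGroup_le_alternatingGroup sign_sMinus)
    (Perm.alternatingGroup_le_of_isPreprimitive_of_isThreeCycle_mem (isPreprimitive_minus ha) h hg)

theorem rotGroup_plus (ha : 1 ≤ a) :
    rotGroup (rPlus a) (sPlus a) = alternatingGroup (Pt a 1) := by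
  obtain ⟨g, hg, h⟩ := exists_isThreeCycle_plus ha
  exact le_antisymm (rotGroup_le_alternatingGroup sign_sPlus)
    (Perm.alternatingGroup_le_of_isPreprimitive_of_isThreeCycle_mem (isPreprimitive_plus ha) h hg)

end Pt

theorem proposition4p2 (a : ℕ) (ha : 1 ≤ a) :
    ((permMap (Pt.rMinus a) (Pt.sMinus a)).IsChiral ∧
      (permMap (Pt.rMinus a) (Pt.sMinus a)).HasType 6 (4 * a + 6) ∧
      rotGroup (Pt.rMinus a) (Pt.sMinus a) = alternatingGroup (Pt a 0) ∧
      Nonempty ((permMap (Pt.rMinus a) (Pt.sMinus a)).autPlus ≃*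
        alternatingGroup (Fin (4 * a + 9))) ∧
      ¬ ∃ φ : rotGroup (Pt.rMinus a) (Pt.sMinus a) ≃* rotGroup (Pt.rMinus a) (Pt.sMinus a),
          φ (genR _ _) = (genR _ _)⁻¹ ∧ φ (genS _ _) = (genS _ _)⁻¹) ∧
    ((permMap (Pt.rPlus a) (Pt.sPlus a)).IsChiral ∧
      (permMap (Pt.rPlus a) (Pt.sPlus a)).HasType 6 (4 * a + 8) ∧
      rotGroup (Pt.rPlus a) (Pt.sPlus a) = alternatingGroup (Pt a 1) ∧
      Nonempty ((permMap (Pt.rPlus a) (Pt.sPlus a)).autPlus ≃*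
        alternatingGroup (Fin (4 * a + 10))) ∧
      ¬ ∃ φ : rotGroup (Pt.rPlus a) (Pt.sPlus a) ≃* rotGroup (Pt.rPlus a) (Pt.sPlus a),
          φ (genR _ _) = (genR _ _)⁻¹ ∧ φ (genS _ _) = (genS _ _)⁻¹) := by
  exact ⟨permMap_chiral rfl Pt.t_mul_t Pt.t_ne_one (Pt.orderOf_rMinus ha) Pt.orderOf_sMinus
      (Pt.chiralWord_minus ha) (Pt.chiralWord_minus_inv ha) (Pt.rotGroup_minus ha) Pt.card_eq,
    permMap_chiral rfl Pt.t_mul_t Pt.t_ne_one (Pt.orderOf_rPlus ha) Pt.orderOf_sPlus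
      (Pt.chiralWord_plus ha) (Pt.chiralWord_plus_inv ha) (Pt.rotGroup_plus ha) Pt.card_eq⟩
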